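/- **Proposition 2.** For real $x$ let $$f(x)=\sum_{m=1}^{\infty}\Big\{1-\Big(1-\frac1{2^m}\Big)^{2^x}\Big\},$$ $$g(x)=-x-\frac{\gamma}{\ln 2}+\frac12-\sum_{m=-\infty}^{0}\exp\!\big(-2^{-m+x}\big)+\sum_{m=1}^{\infty}\Big(1-\exp\!\big(-2^{-m+x}\big)\Big),$$ where $\gamma$ is Euler's constant. All three series converge for every real $x$. There are constants $C$ and $K$ such that, for all integers $k\ge K$ and all real $x$, $$\Big|f(x+k)-\Big(x+k+\frac{\gamma}{\ln 2}-\frac12+g(x)\Big)\Big|\le C\,2^{-x-k};$$ that is, for large positive $k$, $$f(x+k)=x+k+\frac{\gamma}{\ln 2}-\frac12+g(x)+O(2^{-x-k})$$ uniformly in $x$. The function $g$ is nonconstant, has period $1$ (that is, $g(x+1)=g(x)$ for all real $x$), has mean zero (it is integrable on $[0,1]$ and $\int_0^1 g(x)\,dx=0$), and satisfies $|g(x)|\le 0.0000016$ for all real $x$. -/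

import Mathlib

/-- `f(x) = ∑_{m ≥ 1} (1 - (1 - 2^{-m})^{2^x})`: the term of index `m`. -/
noncomputable def fTerm (x : ℝ) (m : ℕ) : ℝ :=
  1 - (1 - 1 / (2 : ℝ) ^ m) ^ ((2 : ℝ) ^ x)

/-- `f(x) = ∑_{m ≥ 1} (1 - (1 - 2^{-m})^{2^x})`, summed over `m = j + 1` with `j ≥ 0`. -/
noncomputable def fSum (x : ℝ) : ℝ := ∑' j : ℕ, fTerm x (j + 1)

/-- The quantity `exp(-2^{-m+x})`, for an integer `m`. -/
noncomputable def expTerm (x : ℝ) (m : ℤ) : ℝ :=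
  Real.exp (-(2 : ℝ) ^ (-(m : ℝ) + x))

/-- `g(x) = -x - γ / ln 2 + 1/2 - ∑_{m ≤ 0} exp(-2^{-m+x}) + ∑_{m ≥ 1} (1 - exp(-2^{-m+x}))`.
The first sum runs over `m = -j`, the second over `m = j + 1`, with `j ≥ 0`. -/
noncomputable def gOsc (x : ℝ) : ℝ :=
  -x - Real.eulerMascheroniConstant / Real.log 2 + 1 / 2
    - ∑' j : ℕ, expTerm x (-(j : ℤ))
    + ∑' j : ℕ, (1 - expTerm x ((j : ℤ) + 1))

/-!
For the expansion, put `n = 2 ^ x`. Up to the linear part, `gOsc x` is the sum of `1 - exp (-n / 2 ^ m)`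
over `m ≥ 1` minus the sum of `exp (-n / 2 ^ m)` over `m ≤ 0`. The second sum is at most `2 / n`. The
terms `1 - (1 - 2 ^ (-m)) ^ n` of `fSum` differ from `1 - exp (-n / 2 ^ m)` by at most
`t ^ 2 * exp (-t) / n` with `t = n / 2 ^ m`, and `t ^ 2 * exp (-t)` is at most
`8 * (exp (-t / 2) - exp (-t))`, which telescopes in `m`. Hence the error is at most `10 / n`
for every real `x` (`abs_fSum_sub_le`), and the periodicity of `gOsc` replaces `x + k` by `x`.

The remaining claims come from the Fourier series of `gOsc`. On `(0, 1]`, `gOsc` is a linear function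
plus the sum of the integer translates of `stepDefect`, so that its Fourier integrals unfold to
integrals over the line. Integration by parts and the substitution `t = 2 ^ u` turn these into
integrals of `exp (-t)` against `log t` or a power of `t` (`integral_mul_gOsc`). The first is
`Γ'(1) = -γ`, and gives mean zero (`integral_gOsc`). The second gives the coefficients
`Γ (1 - 2 π n I / ln 2) / (2 π n I)` for `n ≠ 0` (`integral_exp_mul_gOsc`). They do not vanish, so
`gOsc` is not constant, and by the reflection formula their squared moduli are
`a n / sinh (a n) / (2 π n) ^ 2` with `a = 2 π ^ 2 / ln 2` (`norm_gOscCoeff_sq`).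
The Fourier series therefore converges absolutely to `gOsc`. The coefficients `±1` have modulus about
`7.86e-7` each and the others are negligible, whence the numerical bound (`abs_gOsc_le`).
-/

open MeasureTheory Set Filter Topology

/-! ### The terms of the series and the period -/

lemma expTerm_pos (x : ℝ) (m : ℤ) : 0 < expTerm x m := Real.exp_pos _

lemma expTerm_le_one (x : ℝ) (m : ℤ) : expTerm x m ≤ 1 := by
  unfold expTerm
  rw [Real.exp_le_one_iff]
  have : (0 : ℝ) < 2 ^ (-(m : ℝ) + x) := by positivity
  linarith

lemma exp_neg_le_inv {t : ℝ} (ht : 0 < t) : Real.exp (-t) ≤ t⁻¹ := by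
  rw [Real.exp_neg]
  exact inv_anti₀ ht (by linarith [Real.add_one_le_exp t])

lemma two_rpow_neg_natCast_add (x : ℝ) (j : ℕ) :
    (2 : ℝ) ^ (-(j : ℝ) + x) = 2 ^ x * (1 / 2) ^ j := by
  rw [Real.rpow_add two_pos, Real.rpow_neg two_pos.le, Real.rpow_natCast]
  simp [mul_comm]

lemma expTerm_neg_natCast_le (x : ℝ) (j : ℕ) :
    expTerm x (-(j : ℤ)) ≤ 2 ^ (-x) * (1 / 2) ^ j := by
  unfold expTerm
  refine (exp_neg_le_inv (by positivity)).trans_eq ?_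
  rw [← Real.rpow_neg two_pos.le, ← two_rpow_neg_natCast_add]
  push_cast
  ring_nf

lemma one_sub_expTerm_le (x : ℝ) (m : ℤ) : 1 - expTerm x m ≤ 2 ^ (-(m : ℝ) + x) := by
  have := Real.add_one_le_exp (-(2 : ℝ) ^ (-(m : ℝ) + x))
  unfold expTerm
  linarith

lemma one_sub_expTerm_natCast_succ_le (x : ℝ) (j : ℕ) :
    1 - expTerm x ((j : ℤ) + 1) ≤ 2 ^ x * (1 / 2) ^ (j + 1) := by
  refine (one_sub_expTerm_le x _).trans_eq ?_
  rw [← two_rpow_neg_natCast_add]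
  push_cast
  rfl

lemma summable_half_pow : Summable fun j : ℕ => ((1 : ℝ) / 2) ^ j :=
  summable_geometric_of_lt_one (by norm_num) (by norm_num)

lemma summable_expTerm_neg (x : ℝ) : Summable fun j : ℕ => expTerm x (-(j : ℤ)) :=
  Summable.of_nonneg_of_le (fun _ => (expTerm_pos x _).le) (expTerm_neg_natCast_le x)
    (summable_half_pow.mul_left _)

lemma summable_one_sub_expTerm (x : ℝ) : Summable fun j : ℕ => 1 - expTerm x ((j : ℤ) + 1) :=
  Summable.of_nonneg_of_le (fun _ => sub_nonneg.2 (expTerm_le_one x _))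
    (one_sub_expTerm_natCast_succ_le x)
    (((summable_nat_add_iff 1).2 summable_half_pow).mul_left _)

lemma expTerm_add_one (x : ℝ) (m : ℤ) : expTerm (x + 1) m = expTerm x (m - 1) := by
  unfold expTerm
  push_cast
  ring_nf

/-- Replacing `x` by `x + 1` moves the term `m = 0` from the second series to the first, which
compensates the change of `-x`. -/
lemma gOsc_periodic : Function.Periodic gOsc 1 := by
  intro x
  have h1 : ∑' j : ℕ, expTerm x (-(j : ℤ)) =
      expTerm x 0 + ∑' j : ℕ, expTerm (x + 1) (-(j : ℤ)) := by
    rw [(summable_expTerm_neg x).tsum_eq_zero_add]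
    simp only [Nat.cast_zero, neg_zero, expTerm_add_one]
    congr 2
    ext j
    congr 1
    push_cast
    ring
  have h2 : ∑' j : ℕ, (1 - expTerm (x + 1) ((j : ℤ) + 1)) =
      (1 - expTerm x 0) + ∑' j : ℕ, (1 - expTerm x ((j : ℤ) + 1)) := by
    rw [(summable_one_sub_expTerm (x + 1)).tsum_eq_zero_add]
    simp [expTerm_add_one]
  unfold gOsc
  rw [h1, h2]
  ring

/-! ### The asymptotic expansion of `fSum` -/

lemma exp_neg_add_sq_le_one_sub {a : ℝ} (h0 : 0 ≤ a) (h1 : a ≤ 1 / 2) :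
    Real.exp (-(a + a ^ 2)) ≤ 1 - a := by
  have hs : 0 ≤ a + a ^ 2 := by positivity
  have h := Real.quadratic_le_exp_of_nonneg hs
  have ha : 0 < 1 - a := by linarith
  rw [Real.exp_neg, inv_le_comm₀ (Real.exp_pos _) ha]
  refine le_trans ?_ h
  rw [inv_le_iff_one_le_mul₀ ha]
  -- the difference of the two sides is `a² (1 - a - a² - a³) / 2`
  have h3 : a ^ 3 ≤ 1 / 8 := by
    calc a ^ 3 ≤ (1 / 2) ^ 3 := by gcongr
      _ = 1 / 8 := by norm_num
  have h2 : a ^ 2 ≤ 1 / 4 := by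
    calc a ^ 2 ≤ (1 / 2) ^ 2 := by gcongr
      _ = 1 / 4 := by norm_num
  nlinarith [mul_nonneg (sq_nonneg a) (by linarith : 0 ≤ 1 - a - a ^ 2 - a ^ 3)]

lemma one_sub_rpow_le_exp {a n : ℝ} (h1 : a ≤ 1) (hn : 0 ≤ n) :
    (1 - a) ^ n ≤ Real.exp (-(n * a)) := by
  calc (1 - a) ^ n ≤ (Real.exp (-a)) ^ n :=
        Real.rpow_le_rpow (by linarith) (Real.one_sub_le_exp_neg a) hn
    _ = Real.exp (-(n * a)) := by rw [← Real.exp_mul]; ring_nf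

lemma exp_sub_one_sub_rpow_le {a n : ℝ} (h0 : 0 ≤ a) (h1 : a ≤ 1 / 2) (hn : 0 ≤ n) :
    Real.exp (-(n * a)) - (1 - a) ^ n ≤ n * a ^ 2 * Real.exp (-(n * a)) := by
  have h : Real.exp (-(n * a)) * (1 - n * a ^ 2) ≤ (1 - a) ^ n := by
    calc Real.exp (-(n * a)) * (1 - n * a ^ 2)
        ≤ Real.exp (-(n * a)) * Real.exp (-(n * a ^ 2)) := by
          gcongr
          exact Real.one_sub_le_exp_neg _
      _ = (Real.exp (-(a + a ^ 2))) ^ n := by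
          rw [← Real.exp_mul, ← Real.exp_add]; ring_nf
      _ ≤ (1 - a) ^ n :=
          Real.rpow_le_rpow (Real.exp_pos _).le (exp_neg_add_sq_le_one_sub h0 h1) hn
  linarith

/-- The right-hand side telescopes along `t = n / 2 ^ m`. -/
lemma sq_mul_exp_neg_le {t : ℝ} (ht : 0 ≤ t) :
    t ^ 2 * Real.exp (-t) ≤ 8 * (Real.exp (-(t / 2)) - Real.exp (-t)) := by
  have h := Real.quadratic_le_exp_of_nonneg (div_nonneg ht two_pos.le)
  have h2 : Real.exp (-(t / 2)) = Real.exp (t / 2) * Real.exp (-t) := by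
    rw [← Real.exp_add]; ring_nf
  rw [h2]
  nlinarith [Real.exp_pos (-t)]

lemma fTerm_eq (x : ℝ) (j : ℕ) : fTerm x (j + 1) = (1 - expTerm x ((j : ℤ) + 1)) +
    (expTerm x ((j : ℤ) + 1) - (1 - 1 / (2 : ℝ) ^ (j + 1)) ^ ((2 : ℝ) ^ x)) := by
  unfold fTerm
  ring

lemma expTerm_natCast_succ (x : ℝ) (j : ℕ) :
    expTerm x ((j : ℤ) + 1) = Real.exp (-((2 : ℝ) ^ x * (1 / 2 ^ (j + 1)))) := by
  unfold expTerm
  congr 2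
  have := two_rpow_neg_natCast_add x (j + 1)
  push_cast at this ⊢
  rw [this]
  simp

lemma one_div_two_pow_succ_le (j : ℕ) : (1 : ℝ) / 2 ^ (j + 1) ≤ 1 / 2 := by
  apply one_div_le_one_div_of_le two_pos
  exact le_self_pow₀ one_le_two (by simp)

lemma expTerm_sub_rpow_nonneg (x : ℝ) (j : ℕ) :
    0 ≤ expTerm x ((j : ℤ) + 1) - (1 - 1 / (2 : ℝ) ^ (j + 1)) ^ ((2 : ℝ) ^ x) := by
  rw [expTerm_natCast_succ, sub_nonneg]
  exact one_sub_rpow_le_exp (by linarith [one_div_two_pow_succ_le j]) (by positivity)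

lemma expTerm_sub_rpow_le (x : ℝ) (j : ℕ) :
    expTerm x ((j : ℤ) + 1) - (1 - 1 / (2 : ℝ) ^ (j + 1)) ^ ((2 : ℝ) ^ x) ≤
      8 * 2 ^ (-x) * ((1 - expTerm x ((j : ℤ) + 1)) -
        (1 - expTerm x (((j + 1 : ℕ) : ℤ) + 1))) := by
  have hn : (0 : ℝ) < 2 ^ x := by positivity
  rw [expTerm_natCast_succ x j, expTerm_natCast_succ x (j + 1), Real.rpow_neg two_pos.le]
  have ha : (0 : ℝ) ≤ 1 / 2 ^ (j + 1) := by positivity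
  have h2 : (1 : ℝ) / 2 ^ (j + 1 + 1) = 1 / 2 ^ (j + 1) / 2 := by
    rw [pow_succ]; field_simp
  rw [h2]
  refine (exp_sub_one_sub_rpow_le ha (one_div_two_pow_succ_le j) hn.le).trans ?_
  generalize (1 : ℝ) / 2 ^ (j + 1) = a at ha ⊢
  generalize (2 : ℝ) ^ x = n at hn ⊢
  have h := sq_mul_exp_neg_le (mul_nonneg hn.le ha)
  calc n * a ^ 2 * Real.exp (-(n * a))
      = n⁻¹ * ((n * a) ^ 2 * Real.exp (-(n * a))) := by field_simp
    _ ≤ n⁻¹ * (8 * (Real.exp (-(n * a / 2)) - Real.exp (-(n * a)))) := by gcongr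
    _ = _ := by rw [mul_div_assoc]; ring

lemma summable_one_sub_expTerm_diff (x : ℝ) : Summable fun j : ℕ =>
    (1 - expTerm x ((j : ℤ) + 1)) - (1 - expTerm x (((j + 1 : ℕ) : ℤ) + 1)) :=
  (summable_one_sub_expTerm x).sub ((summable_nat_add_iff 1).2 (summable_one_sub_expTerm x))

lemma summable_expTerm_sub_rpow (x : ℝ) : Summable fun j : ℕ =>
    expTerm x ((j : ℤ) + 1) - (1 - 1 / (2 : ℝ) ^ (j + 1)) ^ ((2 : ℝ) ^ x) :=
  Summable.of_nonneg_of_le (expTerm_sub_rpow_nonneg x) (expTerm_sub_rpow_le x)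
    ((summable_one_sub_expTerm_diff x).mul_left _)

lemma summable_fTerm (x : ℝ) : Summable fun j : ℕ => fTerm x (j + 1) := by
  simp_rw [fTerm_eq]
  exact (summable_one_sub_expTerm x).add (summable_expTerm_sub_rpow x)

lemma tsum_expTerm_sub_rpow_le (x : ℝ) :
    ∑' j : ℕ, (expTerm x ((j : ℤ) + 1) - (1 - 1 / (2 : ℝ) ^ (j + 1)) ^ ((2 : ℝ) ^ x)) ≤
      8 * 2 ^ (-x) := by
  have hs := summable_one_sub_expTerm x
  calc _ ≤ ∑' j : ℕ, 8 * 2 ^ (-x) * ((1 - expTerm x ((j : ℤ) + 1)) -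
        (1 - expTerm x (((j + 1 : ℕ) : ℤ) + 1))) :=
        (summable_expTerm_sub_rpow x).tsum_le_tsum (expTerm_sub_rpow_le x)
          ((summable_one_sub_expTerm_diff x).mul_left _)
    _ = 8 * 2 ^ (-x) * (1 - expTerm x 1) := by
        rw [tsum_mul_left, hs.tsum_sub ((summable_nat_add_iff 1).2 hs), hs.tsum_eq_zero_add]
        simp
    _ ≤ 8 * 2 ^ (-x) * 1 := by
        gcongr
        linarith [expTerm_pos x 1]
    _ = _ := mul_one _

lemma tsum_expTerm_neg_le (x : ℝ) : ∑' j : ℕ, expTerm x (-(j : ℤ)) ≤ 2 * 2 ^ (-x) := by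
  refine ((summable_expTerm_neg x).tsum_le_tsum (expTerm_neg_natCast_le x)
    (summable_half_pow.mul_left _)).trans_eq ?_
  rw [tsum_mul_left, tsum_geometric_two, mul_comm]

/-- The error of the expansion is the sum of the nonnegative differences
`exp (-2 ^ x / 2 ^ m) - (1 - 1 / 2 ^ m) ^ (2 ^ x)` for `m ≥ 1` and of `expTerm x m` for `m ≤ 0`. -/
lemma abs_fSum_sub_le (x : ℝ) :
    |fSum x - (x + Real.eulerMascheroniConstant / Real.log 2 - 1 / 2 + gOsc x)| ≤
      10 * 2 ^ (-x) := by
  have h : fSum x - (x + Real.eulerMascheroniConstant / Real.log 2 - 1 / 2 + gOsc x) =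
      ∑' j : ℕ, (expTerm x ((j : ℤ) + 1) - (1 - 1 / (2 : ℝ) ^ (j + 1)) ^ ((2 : ℝ) ^ x)) +
        ∑' j : ℕ, expTerm x (-(j : ℤ)) := by
    unfold fSum gOsc
    simp_rw [fTerm_eq]
    rw [(summable_one_sub_expTerm x).tsum_add (summable_expTerm_sub_rpow x)]
    ring
  have h1 := tsum_nonneg (L := .unconditional ℕ) (expTerm_sub_rpow_nonneg x)
  have h2 : 0 ≤ ∑' j : ℕ, expTerm x (-(j : ℤ)) := tsum_nonneg fun j => (expTerm_pos x _).le
  rw [h, abs_of_nonneg (add_nonneg h1 h2)]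
  linarith [tsum_expTerm_sub_rpow_le x, tsum_expTerm_neg_le x]

/-! ### The periodized function -/

/-- The function `u ↦ exp (-2 ^ u)`, of which the terms `expTerm x m` are the translates. -/
noncomputable def doubleExp (u : ℝ) : ℝ := Real.exp (-(2 : ℝ) ^ u)

/-- The difference of the indicator function of `(-∞, 0]` and `doubleExp`. It is integrable, and its
translates by integers sum to the two series of `gOsc` for arguments in `(0, 1]`. -/
noncomputable def stepDefect (u : ℝ) : ℝ := (if u ≤ 0 then 1 else 0) - doubleExp u

/-- The density `-doubleExp'`: the law of `log₂ T` for an exponential variable `T`. -/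
noncomputable def doubleExpDensity (u : ℝ) : ℝ := Real.log 2 * 2 ^ u * doubleExp u

lemma expTerm_eq_doubleExp (x : ℝ) (m : ℤ) : expTerm x m = doubleExp (x + ((-m : ℤ) : ℝ)) := by
  unfold expTerm doubleExp
  push_cast
  rw [add_comm]

lemma doubleExp_pos (u : ℝ) : 0 < doubleExp u := Real.exp_pos _

lemma doubleExp_le_one (u : ℝ) : doubleExp u ≤ 1 := by
  unfold doubleExp
  rw [Real.exp_le_one_iff, neg_nonpos]
  positivity

lemma hasDerivAt_doubleExp (u : ℝ) : HasDerivAt doubleExp (-doubleExpDensity u) u := by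
  refine (Real.hasStrictDerivAt_const_rpow two_pos u).hasDerivAt.fun_neg.exp.congr_deriv ?_
  simp only [doubleExpDensity, doubleExp]
  ring

lemma continuous_doubleExp : Continuous doubleExp :=
  continuous_iff_continuousAt.2 fun u => (hasDerivAt_doubleExp u).continuousAt

lemma continuous_doubleExpDensity : Continuous doubleExpDensity := by
  unfold doubleExpDensity
  have h : Continuous fun u : ℝ => (2 : ℝ) ^ u :=
    continuous_const.rpow continuous_id fun _ => Or.inl two_ne_zero
  exact (continuous_const.mul h).mul continuous_doubleExp

lemma measurable_stepDefect : Measurable stepDefect :=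
  (Measurable.ite measurableSet_Iic measurable_const measurable_const).sub
    continuous_doubleExp.measurable

lemma doubleExpDensity_nonneg (u : ℝ) : 0 ≤ doubleExpDensity u := by
  unfold doubleExpDensity
  have := Real.log_pos one_lt_two
  have := doubleExp_pos u
  positivity

lemma abs_stepDefect_le (u : ℝ) : |stepDefect u| ≤ 2 ^ (-|u|) := by
  unfold stepDefect
  have h2 : (0 : ℝ) < 2 ^ u := by positivity
  split_ifs with hu
  · rw [abs_of_nonneg (by linarith [doubleExp_le_one u]), abs_of_nonpos hu, neg_neg]
    unfold doubleExp
    linarith [Real.one_sub_le_exp_neg ((2 : ℝ) ^ u)]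
  · rw [zero_sub, abs_neg, abs_of_pos (doubleExp_pos u), abs_of_pos (not_le.1 hu),
      Real.rpow_neg two_pos.le]
    exact exp_neg_le_inv h2

lemma doubleExpDensity_le (u : ℝ) : doubleExpDensity u ≤ 2 * 2 ^ (-|u|) := by
  have hL : Real.log 2 ≤ 1 := by linarith [Real.log_two_lt_d9]
  have h2 : (0 : ℝ) < 2 ^ u := by positivity
  have h1 : doubleExpDensity u ≤ 2 ^ u * doubleExp u := by
    unfold doubleExpDensity
    rw [mul_assoc]
    exact mul_le_of_le_one_left (mul_pos h2 (doubleExp_pos u)).le hL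
  refine h1.trans ?_
  rcases le_total u 0 with hu | hu
  · rw [abs_of_nonpos hu, neg_neg]
    nlinarith [doubleExp_le_one u]
  · rw [abs_of_nonneg hu, Real.rpow_neg two_pos.le]
    unfold doubleExp
    generalize (2 : ℝ) ^ u = t at h2
    have h := Real.quadratic_le_exp_of_nonneg h2.le
    rw [Real.exp_neg, ← div_eq_mul_inv, ← div_eq_mul_inv, div_le_div_iff₀ (Real.exp_pos _) h2]
    nlinarith

lemma one_add_abs_le (u : ℝ) : 1 + |u| ≤ 4 * 2 ^ (|u| / 2) := by
  have hL := Real.log_two_gt_d9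
  rw [Real.rpow_def_of_pos two_pos]
  have := Real.add_one_le_exp (Real.log 2 * (|u| / 2))
  nlinarith [abs_nonneg u]

lemma two_rpow_neg_abs_mul_le (u : ℝ) : 2 ^ (-|u|) * (1 + |u|) ≤ 4 * (2 : ℝ) ^ (-(|u| / 2)) := by
  calc 2 ^ (-|u|) * (1 + |u|) ≤ 2 ^ (-|u|) * (4 * 2 ^ (|u| / 2)) := by
        gcongr
        exact one_add_abs_le u
    _ = 4 * (2 ^ (-|u|) * 2 ^ (|u| / 2)) := by ring
    _ = _ := by rw [← Real.rpow_add two_pos]; ring_nf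

lemma integrable_two_rpow_neg_abs {c : ℝ} (hc : 0 < c) :
    Integrable fun u : ℝ => (2 : ℝ) ^ (-(|u| / c)) := by
  have hL := Real.log_pos one_lt_two
  rw [← integrableOn_univ, ← Iic_union_Ioi (a := (0 : ℝ))]
  refine IntegrableOn.union ?_ ?_
  · refine (integrableOn_exp_mul_Iic (div_pos hL hc) 0).congr_fun (fun u hu => ?_)
      measurableSet_Iic
    simp only [Real.rpow_def_of_pos two_pos, abs_of_nonpos (mem_Iic.1 hu)]
    ring_nf
  · refine (integrableOn_exp_mul_Ioi (neg_neg_of_pos (div_pos hL hc)) 0).congr_fun (fun u hu => ?_)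
      measurableSet_Ioi
    simp only [Real.rpow_def_of_pos two_pos, abs_of_pos (mem_Ioi.1 hu)]
    ring_nf

lemma tendsto_two_rpow_neg_abs {l : Filter ℝ} (hl : Tendsto (fun u : ℝ => |u|) l atTop) :
    Tendsto (fun u : ℝ => 4 * (2 : ℝ) ^ (-(|u| / 2))) l (𝓝 0) := by
  have h := (tendsto_rpow_atBot_of_base_gt_one 2 one_lt_two).comp
    (tendsto_neg_atTop_atBot.comp (hl.atTop_div_const two_pos))
  simpa using h.const_mul 4

lemma continuousOn_gOsc : ContinuousOn gOsc (Icc 0 1) := by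
  have hcont (m : ℤ) : Continuous fun x => expTerm x m := by
    simp_rw [expTerm_eq_doubleExp]
    exact continuous_doubleExp.comp (continuous_id.add continuous_const)
  unfold gOsc
  refine ContinuousOn.add (ContinuousOn.sub (by fun_prop) ?_) ?_
  · refine continuousOn_tsum (fun j => (hcont _).continuousOn) summable_half_pow fun j x hx => ?_
    rw [Real.norm_of_nonneg (expTerm_pos _ _).le]
    refine (expTerm_neg_natCast_le x j).trans (mul_le_of_le_one_left (by positivity) ?_)
    exact Real.rpow_le_one_of_one_le_of_nonpos one_le_two (neg_nonpos.2 hx.1)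
  · refine continuousOn_tsum (fun j => (continuous_const.sub (hcont _)).continuousOn)
      summable_half_pow fun j x hx => ?_
    rw [Real.norm_of_nonneg (sub_nonneg.2 (expTerm_le_one _ _))]
    refine (one_sub_expTerm_natCast_succ_le x j).trans ?_
    have : (2 : ℝ) ^ x ≤ 2 := Real.rpow_le_self_of_one_le one_le_two hx.2
    rw [pow_succ]
    nlinarith [pow_pos (one_half_pos (α := ℝ)) j]

/-! ### Unfolding the Fourier integrals -/

section IntegrationByParts

variable {E e : ℝ → ℂ}

lemma integrable_stepDefect_mul (heb : ∀ u, ‖e u‖ ≤ 1) (he : Continuous e) :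
    Integrable fun u => (stepDefect u : ℂ) * e u := by
  have h := integrable_two_rpow_neg_abs one_pos
  refine h.mono' ?_ (ae_of_all _ fun u => ?_)
  · exact ((Complex.measurable_ofReal.comp measurable_stepDefect).mul
      he.measurable).aestronglyMeasurable
  · rw [norm_mul, Complex.norm_real, Real.norm_eq_abs, div_one]
    exact (mul_le_of_le_one_right (abs_nonneg _) (heb u)).trans (abs_stepDefect_le u)

lemma integrable_doubleExpDensity_mul (hEb : ∀ u, ‖E u‖ ≤ 1 + |u|) (hE : Continuous E) :
    Integrable fun u => (doubleExpDensity u : ℂ) * E u := by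
  have h := (integrable_two_rpow_neg_abs two_pos).const_mul 8
  refine h.mono' ?_ (ae_of_all _ fun u => ?_)
  · exact ((Complex.continuous_ofReal.comp continuous_doubleExpDensity).mul
      hE).aestronglyMeasurable
  · rw [norm_mul, Complex.norm_real, Real.norm_of_nonneg (doubleExpDensity_nonneg u)]
    calc doubleExpDensity u * ‖E u‖ ≤ 2 * 2 ^ (-|u|) * (1 + |u|) :=
          mul_le_mul (doubleExpDensity_le u) (hEb u) (norm_nonneg _) (by positivity)
      _ ≤ 8 * 2 ^ (-(|u| / 2)) := by linarith [two_rpow_neg_abs_mul_le u]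

lemma tendsto_stepDefect_mul (hEb : ∀ u, ‖E u‖ ≤ 1 + |u|) {l : Filter ℝ}
    (hl : Tendsto (fun u : ℝ => |u|) l atTop) :
    Tendsto (fun u => (stepDefect u : ℂ) * E u) l (𝓝 0) := by
  refine squeeze_zero_norm (fun u => ?_) (tendsto_two_rpow_neg_abs hl)
  rw [norm_mul, Complex.norm_real, Real.norm_eq_abs]
  exact (mul_le_mul (abs_stepDefect_le u) (hEb u) (norm_nonneg _) (by positivity)).trans
    (two_rpow_neg_abs_mul_le u)

/-- Integration by parts against `stepDefect`, whose derivative is `doubleExpDensity` away from the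
jump at `0`. -/
lemma integral_stepDefect_mul (hEe : ∀ u, HasDerivAt E (e u) u) (hEb : ∀ u, ‖E u‖ ≤ 1 + |u|)
    (heb : ∀ u, ‖e u‖ ≤ 1) (he : Continuous e) :
    ∫ u, (stepDefect u : ℂ) * e u = E 0 - ∫ u, (doubleExpDensity u : ℂ) * E u := by
  have hE : Continuous E := continuous_iff_continuousAt.2 fun u => (hEe u).continuousAt
  have i1 := integrable_stepDefect_mul heb he
  have i2 := integrable_doubleExpDensity_mul hEb hE
  have hW (u : ℝ) : HasDerivAt (fun v => (doubleExp v : ℂ)) (-(doubleExpDensity u : ℂ)) u := by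
    simpa using (hasDerivAt_doubleExp u).ofReal_comp
  have right : ∫ u in Ioi 0, ((stepDefect u : ℂ) * e u + doubleExpDensity u * E u) =
      doubleExp 0 * E 0 := by
    have hd (u : ℝ) : HasDerivAt (fun v => -(doubleExp v : ℂ) * E v)
        (-(doubleExp u : ℂ) * e u + doubleExpDensity u * E u) u := by
      refine ((hW u).neg.mul (hEe u)).congr_deriv ?_
      simp only [Pi.neg_apply]
      ring
    have heq : EqOn (fun u => (stepDefect u : ℂ) * e u + doubleExpDensity u * E u)
        (fun u => -(doubleExp u : ℂ) * e u + doubleExpDensity u * E u) (Ioi 0) := by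
      intro u hu
      simp [stepDefect, not_le.2 (mem_Ioi.1 hu)]
    rw [setIntegral_congr_fun measurableSet_Ioi heq,
      integral_Ioi_of_hasDerivAt_of_tendsto' (m := 0) (fun u _ => hd u)
        ((i1.add i2).integrableOn.congr_fun heq measurableSet_Ioi)]
    · ring
    · refine (tendsto_stepDefect_mul hEb tendsto_abs_atTop_atTop).congr' ?_
      filter_upwards [eventually_gt_atTop 0] with u hu
      simp [stepDefect, not_le.2 hu]
  have left : ∫ u in Iic 0, ((stepDefect u : ℂ) * e u + doubleExpDensity u * E u) =
      (1 - doubleExp 0) * E 0 := by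
    have hd (u : ℝ) : HasDerivAt (fun v => (1 - (doubleExp v : ℂ)) * E v)
        ((1 - (doubleExp u : ℂ)) * e u + doubleExpDensity u * E u) u := by
      refine (((hW u).const_sub 1).mul (hEe u)).congr_deriv ?_
      ring
    have heq : EqOn (fun u => (stepDefect u : ℂ) * e u + doubleExpDensity u * E u)
        (fun u => (1 - (doubleExp u : ℂ)) * e u + doubleExpDensity u * E u) (Iic 0) := by
      intro u hu
      simp [stepDefect, mem_Iic.1 hu]
    rw [setIntegral_congr_fun measurableSet_Iic heq,
      integral_Iic_of_hasDerivAt_of_tendsto' (m := 0) (fun u _ => hd u)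
        ((i1.add i2).integrableOn.congr_fun heq measurableSet_Iic)]
    · ring
    · refine (tendsto_stepDefect_mul hEb tendsto_abs_atBot_atTop).congr' ?_
      filter_upwards [eventually_le_atBot 0] with u hu
      simp [stepDefect, hu]
  have total := intervalIntegral.integral_Iic_add_Ioi (b := 0) (i1.add i2).integrableOn
    (i1.add i2).integrableOn
  simp only [Pi.add_apply] at total
  rw [left, right, integral_add i1 i2] at total
  rw [eq_sub_iff_add_eq, ← total]
  ring

/-- The substitution `t = 2 ^ u`. -/
lemma integral_doubleExpDensity_mul (E : ℝ → ℂ) :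
    ∫ u, (doubleExpDensity u : ℂ) * E u =
      ∫ t in Ioi (0 : ℝ), (Real.exp (-t) : ℂ) * E (Real.log t / Real.log 2) := by
  have hL := Real.log_pos one_lt_two
  have himg : (fun u : ℝ => (2 : ℝ) ^ u) '' univ = Ioi 0 := by
    ext t
    simp only [image_univ, mem_range, mem_Ioi]
    constructor
    · rintro ⟨u, rfl⟩
      positivity
    · intro ht
      exact ⟨Real.logb 2 t, Real.rpow_logb two_pos (by norm_num) ht⟩
  rw [← himg, integral_image_eq_integral_abs_deriv_smul MeasurableSet.univ
    (f' := fun u => 2 ^ u * Real.log 2)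
    (fun u _ => (Real.hasStrictDerivAt_const_rpow two_pos u).hasDerivAt.hasDerivWithinAt)
    (Real.strictMono_rpow_of_base_gt_one one_lt_two).injective.injOn, setIntegral_univ]
  congr 1
  ext u
  have h2 : (0 : ℝ) < 2 ^ u := by positivity
  rw [abs_of_pos (by positivity), Real.log_rpow two_pos, mul_div_cancel_right₀ _ hL.ne',
    Complex.real_smul]
  simp only [doubleExpDensity, doubleExp]
  push_cast
  ring

/-- The integral over a period of the periodization of an integrable function. -/
lemma integral_tsum_comp_add_int {F : ℝ → ℂ} (hF : Integrable F) :
    ∫ x in (0 : ℝ)..1, ∑' n : ℤ, F (x + n) = ∫ x, F x := by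
  have h1 := hF.hasSum_intervalIntegral_comp_add_int
  have h2 := hF.norm.hasSum_intervalIntegral_comp_add_int.summable
  simp only [intervalIntegral.integral_of_le zero_le_one] at h1 h2 ⊢
  exact (hasSum_integral_of_summable_integral_norm (F := fun (n : ℤ) x => F (x + n))
    (fun n => (hF.comp_add_right (n : ℝ)).integrableOn) h2).unique h1

/-- The constant term of `gOsc`. -/
noncomputable def gOscConst : ℝ := 1 / 2 - Real.eulerMascheroniConstant / Real.log 2

lemma hasSum_stepDefect {x : ℝ} (hx : x ∈ Ioc (0 : ℝ) 1) :
    HasSum (fun n : ℤ => stepDefect (x + n)) (gOsc x - (gOscConst - x)) := by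
  have h1 : HasSum (fun n : ℕ => stepDefect (x + ((n : ℤ) : ℝ)))
      (-∑' j : ℕ, expTerm x (-(j : ℤ))) := by
    have h (n : ℕ) : stepDefect (x + ((n : ℤ) : ℝ)) = -expTerm x (-(n : ℤ)) := by
      have : ¬ x + n ≤ 0 := not_le.2 (add_pos_of_pos_of_nonneg hx.1 n.cast_nonneg)
      simp [expTerm_eq_doubleExp, stepDefect, this]
    simp_rw [h]
    exact (summable_expTerm_neg x).hasSum.neg
  have h2 : HasSum (fun n : ℕ => stepDefect (x + ((-((n : ℤ) + 1) : ℤ) : ℝ)))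
      (∑' j : ℕ, (1 - expTerm x ((j : ℤ) + 1))) := by
    have h (n : ℕ) : stepDefect (x + ((-((n : ℤ) + 1) : ℤ) : ℝ)) =
        1 - expTerm x ((n : ℤ) + 1) := by
      have : x + ((-((n : ℤ) + 1) : ℤ) : ℝ) ≤ 0 := by
        push_cast
        linarith [hx.2, n.cast_nonneg (α := ℝ)]
      rw [expTerm_eq_doubleExp, stepDefect, if_pos this]
    simp_rw [h]
    exact (summable_one_sub_expTerm x).hasSum
  convert HasSum.of_nat_of_neg_add_one (f := fun n : ℤ => stepDefect (x + n)) h1 h2 using 1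
  unfold gOsc gOscConst
  ring

/-- The integral of `gOsc` against a `1`-periodic function with antiderivative `E`: the sum over
integer translates unfolds to an integral over the line. -/
lemma integral_mul_gOsc (hEe : ∀ u, HasDerivAt E (e u) u) (hEb : ∀ u, ‖E u‖ ≤ 1 + |u|)
    (heb : ∀ u, ‖e u‖ ≤ 1) (he : Continuous e) (hp : ∀ (u : ℝ) (n : ℤ), e (u + n) = e u) :
    ∫ x in (0 : ℝ)..1, e x * gOsc x =
      (gOscConst - 1) * E 1 + (1 - gOscConst) * E 0 + (∫ x in (0 : ℝ)..1, E x) -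
        ∫ t in Ioi (0 : ℝ), (Real.exp (-t) : ℂ) * E (Real.log t / Real.log 2) := by
  have hE : Continuous E := continuous_iff_continuousAt.2 fun u => (hEe u).continuousAt
  have hg : ContinuousOn (fun x => (gOsc x : ℂ)) (uIcc 0 1) := by
    rw [uIcc_of_le zero_le_one]
    exact Complex.continuous_ofReal.comp_continuousOn continuousOn_gOsc
  have hl : Continuous fun x : ℝ => ((gOscConst : ℂ) - x) :=
    continuous_const.sub Complex.continuous_ofReal
  have h1 : ∫ x in (0 : ℝ)..1, e x * (gOsc x - (gOscConst - x)) =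
      E 0 - ∫ t in Ioi (0 : ℝ), (Real.exp (-t) : ℂ) * E (Real.log t / Real.log 2) := by
    rw [← integral_doubleExpDensity_mul, ← integral_stepDefect_mul hEe hEb heb he,
      ← integral_tsum_comp_add_int (integrable_stepDefect_mul heb he)]
    refine intervalIntegral.integral_congr_Ioo_of_le zero_le_one fun x hx => ?_
    have h := Complex.hasSum_ofReal.2 (hasSum_stepDefect (Ioo_subset_Ioc_self hx))
    simp_rw [hp]
    rw [(h.mul_right (e x)).tsum_eq]
    push_cast
    ring
  have h2 : ∫ x in (0 : ℝ)..1, ((gOscConst - x) * e x - E x) =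
      (gOscConst - 1) * E 1 - gOscConst * E 0 := by
    have hd (x : ℝ) : HasDerivAt (fun x : ℝ => ((gOscConst : ℂ) - x) * E x)
        ((gOscConst - x) * e x - E x) x := by
      refine (((hasDerivAt_id x).ofReal_comp.const_sub (gOscConst : ℂ)).mul (hEe x)).congr_deriv ?_
      simp
      ring
    rw [intervalIntegral.integral_eq_sub_of_hasDerivAt (fun x _ => hd x)
      (((hl.mul he).sub hE).intervalIntegrable _ _)]
    simp
  have hle : IntervalIntegrable (fun x : ℝ => ((gOscConst : ℂ) - x) * e x) volume 0 1 :=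
    (hl.mul he).intervalIntegrable _ _
  rw [intervalIntegral.integral_sub hle (hE.intervalIntegrable _ _), sub_eq_iff_eq_add] at h2
  have h3 : ∫ x in (0 : ℝ)..1, e x * gOsc x =
      (∫ x in (0 : ℝ)..1, e x * (gOsc x - (gOscConst - x))) +
        ∫ x in (0 : ℝ)..1, (gOscConst - x) * e x := by
    rw [← intervalIntegral.integral_add]
    · congr 1
      ext x
      ring
    · exact (he.continuousOn.mul (hg.sub hl.continuousOn)).intervalIntegrable
    · exact hle
  rw [h3, h1, h2]
  ring

end IntegrationByParts

/-! ### Mean value and Fourier coefficients -/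

lemma integral_exp_neg_mul_log :
    ∫ t in Ioi (0 : ℝ), (Real.exp (-t) : ℂ) * Real.log t = -Real.eulerMascheroniConstant := by
  have h1 := Complex.hasDerivAt_GammaIntegral (s := 1) (by simp)
  have h2 : HasDerivAt Complex.GammaIntegral (-Real.eulerMascheroniConstant) 1 := by
    refine Complex.hasDerivAt_Gamma_one.congr_of_eventuallyEq ?_
    filter_upwards [(isOpen_lt continuous_const Complex.continuous_re).mem_nhds
      (show (0 : ℝ) < (1 : ℂ).re by simp)] with s hs
    exact (Complex.Gamma_eq_integral hs).symm
  rw [← h1.unique h2]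
  simp [mul_comm]

/-- The Fourier coefficient of index `0` vanishes: the constant in `gOsc` is chosen for this. -/
lemma integral_gOsc : ∫ x in (0 : ℝ)..1, gOsc x = 0 := by
  have h := integral_mul_gOsc (E := fun u : ℝ => (u : ℂ)) (e := fun _ => 1)
    (fun u => (hasDerivAt_id u).ofReal_comp) (by simp) (by simp) continuous_const (by simp)
  have h1 : ∫ t in Ioi (0 : ℝ), (Real.exp (-t) : ℂ) * ((Real.log t / Real.log 2 : ℝ) : ℂ) =
      -Real.eulerMascheroniConstant / Real.log 2 := by
    rw [← integral_exp_neg_mul_log, ← integral_div]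
    congr 1
    ext t
    push_cast
    ring
  have h2 : ∫ x in (0 : ℝ)..1, (x : ℂ) = 1 / 2 := by
    rw [intervalIntegral.integral_ofReal, integral_id]
    norm_num
  rw [h1, h2] at h
  simp only [one_mul, intervalIntegral.integral_ofReal] at h
  rw [← Complex.ofReal_eq_zero, h, gOscConst]
  push_cast
  ring

/-- For `n ≠ 0` the antiderivative of the character is a multiple of it, and
`exp (-(2 π n I) log₂ t)` is a power of `t`, so that the integral is one of Euler's. -/
lemma integral_exp_mul_gOsc {n : ℤ} (hn : n ≠ 0) :
    ∫ x in (0 : ℝ)..1, Complex.exp (-(2 * Real.pi * n * Complex.I) * x) * gOsc x =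
      Complex.Gamma (1 - 2 * Real.pi * n / Real.log 2 * Complex.I) /
        (2 * Real.pi * n * Complex.I) := by
  have hpi : (Real.pi : ℂ) ≠ 0 := by exact_mod_cast Real.pi_ne_zero
  have hn' : (n : ℂ) ≠ 0 := by exact_mod_cast hn
  set w : ℂ := -(2 * Real.pi * n * Complex.I) with hw
  have hw0 : w ≠ 0 := by
    rw [hw, neg_ne_zero]
    exact mul_ne_zero (mul_ne_zero (mul_ne_zero two_ne_zero hpi) hn') Complex.I_ne_zero
  have hwre (u : ℝ) : ‖Complex.exp (w * u)‖ = 1 := by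
    rw [Complex.norm_exp]
    simp [hw]
  have hwnorm : 1 ≤ ‖w‖ := by
    have h1 : (1 : ℝ) ≤ |(n : ℝ)| := by exact_mod_cast Int.one_le_abs hn
    have h2 : ‖w‖ = 2 * Real.pi * |(n : ℝ)| := by
      simp [hw, abs_of_pos Real.pi_pos]
    rw [h2]
    nlinarith [Real.pi_gt_three]
  have hexp (m : ℤ) : Complex.exp (w * m) = 1 := by
    rw [Complex.exp_eq_one_iff]
    exact ⟨-(n * m), by rw [hw]; push_cast; ring⟩
  have hd (u : ℝ) : HasDerivAt (fun u : ℝ => Complex.exp (w * u) / w) (Complex.exp (w * u)) u := by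
    have := (((hasDerivAt_id u).ofReal_comp.const_mul w).cexp).div_const w
    refine this.congr_deriv ?_
    simp [hw0]
  have h := integral_mul_gOsc hd (fun u => ?_) (fun u => (hwre u).le) (by fun_prop) (fun u m => ?_)
  · have h1 : ∫ x in (0 : ℝ)..1, Complex.exp (w * x) / w = 0 := by
      rw [intervalIntegral.integral_div, integral_exp_mul_complex hw0]
      have := hexp 1
      simp at this
      simp [this]
    have h2 : ∫ t in Ioi (0 : ℝ), (Real.exp (-t) : ℂ) *
        (Complex.exp (w * ((Real.log t / Real.log 2 : ℝ) : ℂ)) / w) =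
        Complex.Gamma (1 + w / Real.log 2) / w := by
      have hre : (w / (Real.log 2 : ℂ)).re = 0 := by
        rw [Complex.div_ofReal_re]
        simp [hw]
      rw [Complex.Gamma_eq_integral (by rw [Complex.add_re, hre]; simp), Complex.GammaIntegral,
        ← integral_div]
      refine setIntegral_congr_fun measurableSet_Ioi fun t ht => ?_
      have ht' : (t : ℂ) ≠ 0 := by exact_mod_cast (mem_Ioi.1 ht).ne'
      simp only [add_sub_cancel_left]
      rw [Complex.cpow_def_of_ne_zero ht', ← Complex.ofReal_log (mem_Ioi.1 ht).le]
      push_cast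
      ring_nf
    have h3 : Complex.exp (w * (1 : ℝ)) = 1 := by simpa using hexp 1
    rw [h, h1, h2, h3]
    have h4 : 1 - 2 * Real.pi * n / Real.log 2 * Complex.I = 1 + w / Real.log 2 := by
      rw [hw]; ring
    have h5 : 2 * Real.pi * n * Complex.I = -w := by rw [hw]; ring
    rw [h4, h5]
    simp
    ring
  · rw [norm_div, hwre]
    have : 1 / ‖w‖ ≤ 1 := by rw [div_le_one (by linarith)]; exact hwnorm
    linarith [abs_nonneg u]
  · push_cast
    rw [mul_add, Complex.exp_add, hexp, mul_one]

/-! ### Size of the Fourier coefficients -/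

/-- Euler's reflection formula on the line of real part `1`. -/
lemma norm_Gamma_one_sub_mul_I_sq {y : ℝ} (hy : y ≠ 0) :
    ‖Complex.Gamma (1 - y * Complex.I)‖ ^ 2 = Real.pi * y / Real.sinh (Real.pi * y) := by
  have hy' : (y : ℂ) ≠ 0 := by exact_mod_cast hy
  have hconj : (starRingEnd ℂ) (1 - y * Complex.I) = y * Complex.I + 1 := by
    simp
    ring
  have h := Complex.Gamma_mul_Gamma_one_sub (y * Complex.I)
  rw [← mul_assoc, Complex.sin_mul_I] at h
  rw [← Complex.ofReal_inj, Complex.ofReal_pow, ← Complex.mul_conj', ← Complex.Gamma_conj, hconj,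
    Complex.Gamma_add_one _ (mul_ne_zero hy' Complex.I_ne_zero)]
  calc _ = y * Complex.I * (Complex.Gamma (y * Complex.I) *
        Complex.Gamma (1 - y * Complex.I)) := by ring
    _ = _ := by
      rw [h]
      push_cast
      field_simp

/-- The Fourier coefficients of `gOsc`, with respect to the characters `exp (2 π n I x)`. -/
noncomputable def gOscCoeff (n : ℤ) : ℂ :=
  ∫ x in (0 : ℝ)..1, Complex.exp (-(2 * Real.pi * n * Complex.I) * x) * gOsc x

lemma gOscCoeff_zero : gOscCoeff 0 = 0 := by
  simp [gOscCoeff, intervalIntegral.integral_ofReal, integral_gOsc]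

lemma gOscCoeff_ne_zero {n : ℤ} (hn : n ≠ 0) : gOscCoeff n ≠ 0 := by
  have hpi : (Real.pi : ℂ) ≠ 0 := by exact_mod_cast Real.pi_ne_zero
  have hn' : (n : ℂ) ≠ 0 := by exact_mod_cast hn
  rw [gOscCoeff, integral_exp_mul_gOsc hn]
  refine div_ne_zero (Complex.Gamma_ne_zero_of_re_pos ?_) (by simp [hpi, hn'])
  have : (2 * Real.pi * n / Real.log 2 * Complex.I : ℂ) =
      ((2 * Real.pi * n / Real.log 2 : ℝ) : ℂ) * Complex.I := by push_cast; rfl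
  rw [this, Complex.sub_re, Complex.re_ofReal_mul]
  simp

/-- The exponential decay rate `2 π² / ln 2` of the squared Fourier coefficients. -/
noncomputable def decayRate : ℝ := 2 * Real.pi ^ 2 / Real.log 2

lemma decayRate_gt : 28.47 < decayRate := by
  have h1 := Real.pi_gt_d6
  have h2 := Real.log_two_lt_d9
  have h3 : (3.14159 : ℝ) ^ 2 ≤ Real.pi ^ 2 := by gcongr; linarith
  rw [decayRate, lt_div_iff₀ (Real.log_pos one_lt_two)]
  norm_num at h2 h3 ⊢
  linarith

lemma decayRate_lt : decayRate < 28.48 := by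
  have h1 := Real.pi_lt_d6
  have h2 := Real.log_two_gt_d9
  have h3 : Real.pi ^ 2 ≤ (3.1416 : ℝ) ^ 2 := by
    have := Real.pi_pos
    gcongr
    linarith
  rw [decayRate, div_lt_iff₀ (Real.log_pos one_lt_two)]
  norm_num at h2 h3 ⊢
  linarith

lemma exp_decayRate_gt : 2.28e12 < Real.exp decayRate := by
  have h1 : (2.7182818 : ℝ) ^ 28 ≤ Real.exp 1 ^ 28 := by
    gcongr
    linarith [Real.exp_one_gt_d9]
  have h2 := Real.quadratic_le_exp_of_nonneg (x := 0.47) (by norm_num)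
  have h3 : Real.exp 1 ^ 28 * Real.exp 0.47 = Real.exp 28.47 := by
    rw [← Real.exp_nat_mul, ← Real.exp_add]
    norm_num
  have h4 : Real.exp 28.47 < Real.exp decayRate := Real.exp_lt_exp.2 decayRate_gt
  refine lt_of_le_of_lt ?_ h4
  rw [← h3]
  calc (2.28e12 : ℝ) ≤ 2.7182818 ^ 28 * (1 + 0.47 + 0.47 ^ 2 / 2) := by norm_num
    _ ≤ _ := by gcongr

lemma norm_gOscCoeff_sq {n : ℤ} (hn : n ≠ 0) : ‖gOscCoeff n‖ ^ 2 =
    decayRate * n / Real.sinh (decayRate * n) / (4 * Real.pi ^ 2 * n ^ 2) := by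
  have hL := Real.log_pos one_lt_two
  have hpi := Real.pi_ne_zero
  have hn' : (n : ℝ) ≠ 0 := by exact_mod_cast hn
  have h1 : (2 * Real.pi * n / Real.log 2 * Complex.I : ℂ) =
      ((2 * Real.pi * n / Real.log 2 : ℝ) : ℂ) * Complex.I := by push_cast; rfl
  have h2 : ‖(2 * Real.pi * n * Complex.I : ℂ)‖ ^ 2 = 4 * Real.pi ^ 2 * n ^ 2 := by
    simp [mul_pow]
    norm_num
  have h3 : Real.pi * (2 * Real.pi * n / Real.log 2) = decayRate * n := by
    rw [decayRate]
    ring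
  rw [gOscCoeff, integral_exp_mul_gOsc hn, norm_div, div_pow, h2, h1,
    norm_Gamma_one_sub_mul_I_sq (by positivity), h3]

lemma norm_gOscCoeff_neg (n : ℤ) : ‖gOscCoeff (-n)‖ = ‖gOscCoeff n‖ := by
  rcases eq_or_ne n 0 with rfl | hn
  · simp
  rw [← sq_eq_sq₀ (norm_nonneg _) (norm_nonneg _), norm_gOscCoeff_sq hn,
    norm_gOscCoeff_sq (neg_ne_zero.2 hn)]
  push_cast
  rw [mul_neg, Real.sinh_neg, neg_div_neg_eq, neg_sq]

/-- With `a` the decay rate, `sinh (a (k + 1)) ≥ sinh a * exp (a k)` reduces the bound to the first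
coefficient, of modulus about `7.86e-7`. -/
lemma norm_gOscCoeff_natCast_succ_le (k : ℕ) :
    ‖gOscCoeff ((k : ℤ) + 1)‖ ≤ 7.98e-7 * (1 / 1000) ^ k := by
  have hA := decayRate_gt
  have hA0 : 0 < decayRate := by linarith
  have hexp := exp_decayRate_gt
  have hsinh : 1.139e12 ≤ Real.sinh decayRate := by
    have : Real.exp (-decayRate) ≤ 1 := Real.exp_le_one_iff.2 (by linarith)
    rw [Real.sinh_eq]
    linarith
  have hpi : (39.47 : ℝ) ≤ 4 * Real.pi ^ 2 := by nlinarith [Real.pi_gt_d6]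
  have hpow : ((1000 : ℝ) ^ k) ^ 2 ≤ Real.exp (decayRate * k) := by
    rw [mul_comm, Real.exp_nat_mul, ← pow_mul, mul_comm k 2, pow_mul]
    gcongr
    linarith
  have hgrow : Real.sinh decayRate * Real.exp (decayRate * k) ≤
      Real.sinh (decayRate * (k + 1)) := by
    have h : decayRate * (k + 1) = decayRate * k + decayRate := by ring
    have hk : 0 ≤ decayRate * k := by positivity
    have hs : 0 ≤ Real.sinh (decayRate * k) := Real.sinh_nonneg_iff.2 hk
    rw [h, Real.sinh_add, ← Real.cosh_add_sinh (decayRate * k)]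
    nlinarith [Real.sinh_lt_cosh decayRate]
  have hk1 : (1 : ℝ) ≤ k + 1 := by linarith [k.cast_nonneg (α := ℝ)]
  rw [← sq_le_sq₀ (norm_nonneg _) (by positivity), norm_gOscCoeff_sq (by positivity)]
  push_cast
  have hS : 1.139e12 * ((1000 : ℝ) ^ k) ^ 2 ≤ Real.sinh (decayRate * (k + 1)) :=
    le_trans (by gcongr) hgrow
  calc decayRate * (k + 1) / Real.sinh (decayRate * (k + 1)) / (4 * Real.pi ^ 2 * (k + 1) ^ 2)
      = decayRate / (Real.sinh (decayRate * (k + 1)) * (4 * Real.pi ^ 2) * (k + 1)) := by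
        field_simp
    _ ≤ 28.48 / (1.139e12 * ((1000 : ℝ) ^ k) ^ 2 * 39.47 * 1) := by
        gcongr
        exact decayRate_lt.le
    _ ≤ (7.98e-7 * (1 / 1000) ^ k) ^ 2 := by
        rw [mul_pow, one_div, inv_pow, inv_pow]
        rw [div_le_iff₀ (by positivity)]
        field_simp
        norm_num

lemma hasSum_thousandth_pow :
    HasSum (fun k : ℕ => (7.98e-7 : ℝ) * (1 / 1000) ^ k) (7.98e-7 * (1000 / 999)) := by
  have := (hasSum_geometric_of_lt_one (r := (1 / 1000 : ℝ)) (by norm_num) (by norm_num)).mul_left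
    7.98e-7
  norm_num at this ⊢
  exact this

/-- A summable majorant of the moduli of the Fourier coefficients. -/
lemma exists_majorant_gOscCoeff :
    ∃ b : ℤ → ℝ, ∃ S ≤ 0.0000016, HasSum b S ∧ ∀ n, ‖gOscCoeff n‖ ≤ b n := by
  refine ⟨fun n => if n = 0 then 0 else 7.98e-7 * (1 / 1000) ^ (n.natAbs - 1), _, ?_,
    HasSum.of_add_one_of_neg_add_one (m := 7.98e-7 * (1000 / 999)) (m' := 7.98e-7 * (1000 / 999))
      ?_ ?_, fun n => ?_⟩
  · norm_num
  · convert hasSum_thousandth_pow using 2 with k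
    rw [if_neg (by lia)]
    rfl
  · convert hasSum_thousandth_pow using 2 with k
    rw [if_neg (by lia), Int.natAbs_neg]
    rfl
  · dsimp only
    split_ifs with hn
    · rw [hn, gOscCoeff_zero, norm_zero]
    · have hk : (((n.natAbs - 1 : ℕ) : ℤ) + 1) = n.natAbs := by lia
      have h := norm_gOscCoeff_natCast_succ_le (n.natAbs - 1)
      rw [hk] at h
      rcases Int.natAbs_eq n with h' | h'
      · rwa [← h'] at h
      · rw [h', norm_gOscCoeff_neg, Int.natAbs_neg, Int.natAbs_natCast]
        exact h

/-! ### The Fourier series of `gOsc` -/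

/-- `gOsc` as a function on the circle of length `1`. -/
noncomputable def gOscCircle : C(AddCircle (1 : ℝ), ℂ) where
  toFun := AddCircle.liftIco 1 0 fun x => (gOsc x : ℂ)
  continuous_toFun := by
    refine AddCircle.liftIco_zero_continuous ?_
      (Complex.continuous_ofReal.comp_continuousOn continuousOn_gOsc)
    have := gOsc_periodic 0
    rw [zero_add] at this
    rw [this]

lemma fourierCoeff_gOscCircle (n : ℤ) : fourierCoeff gOscCircle n = gOscCoeff n := by
  have h : fourierCoeff gOscCircle n =
      fourierCoeff (AddCircle.liftIco 1 0 fun x => (gOsc x : ℂ)) n := rfl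
  rw [h, fourierCoeff_liftIco_eq, fourierCoeffOn_eq_integral, gOscCoeff]
  simp only [zero_add, sub_zero, fourier_coe_apply, smul_eq_mul]
  simp only [one_div, inv_one, one_smul]
  congr 1
  ext x
  congr 2
  push_cast
  ring

lemma abs_gOsc_le (x : ℝ) : |gOsc x| ≤ 0.0000016 := by
  obtain ⟨y, hy, hxy⟩ := gOsc_periodic.exists_mem_Ico₀ zero_lt_one x
  obtain ⟨b, S, hS, hb, hle⟩ := exists_majorant_gOscCoeff
  have hsum : Summable (fourierCoeff gOscCircle) := by
    refine Summable.of_norm_bounded hb.summable fun n => ?_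
    rw [fourierCoeff_gOscCircle]
    exact hle n
  have h := has_pointwise_sum_fourier_series_of_summable hsum (y : AddCircle (1 : ℝ))
  have hval : gOscCircle (y : AddCircle (1 : ℝ)) = (gOsc y : ℂ) :=
    AddCircle.liftIco_zero_coe_apply (f := fun x => (gOsc x : ℂ)) hy
  have hn := h.norm_le_of_bounded hb fun n => by
    rw [norm_smul, fourierCoeff_gOscCircle, fourier_apply, Circle.norm_coe, mul_one]
    exact hle n
  rw [hval, Complex.norm_real, Real.norm_eq_abs] at hn
  rw [hxy]
  exact hn.trans hS

lemma exists_gOsc_ne : ∃ x y : ℝ, gOsc x ≠ gOsc y := by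
  by_contra! h
  -- a constant function of mean zero vanishes, so its first Fourier coefficient does too
  have h0 : gOsc 0 = 0 := by
    have hi := integral_gOsc
    simp_rw [fun x => h x 0] at hi
    simpa using hi
  refine gOscCoeff_ne_zero one_ne_zero ?_
  simp [gOscCoeff, fun x => (h x 0).trans h0]

theorem proposition2 :
    -- the series defining `f` and `g` converge for every real `x`
    (∀ x : ℝ, Summable (fun j : ℕ => fTerm x (j + 1))) ∧
    (∀ x : ℝ, Summable (fun j : ℕ => expTerm x (-(j : ℤ)))) ∧
    (∀ x : ℝ, Summable (fun j : ℕ => 1 - expTerm x ((j : ℤ) + 1))) ∧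
    -- the expansion for large `k`, with an error bounded by a constant multiple of `2^{-x-k}`
    (∃ C : ℝ, ∃ K : ℕ, ∀ k : ℕ, K ≤ k → ∀ x : ℝ,
      |fSum (x + k) -
          (x + k + Real.eulerMascheroniConstant / Real.log 2 - 1 / 2 + gOsc x)| ≤
        C * (2 : ℝ) ^ (-x - (k : ℝ))) ∧
    -- `g` is nonconstant, of period 1, of mean zero, and small
    (∃ x y : ℝ, gOsc x ≠ gOsc y) ∧
    Function.Periodic gOsc 1 ∧
    (IntervalIntegrable gOsc MeasureTheory.volume 0 1 ∧ ∫ x in (0 : ℝ)..1, gOsc x = 0) ∧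
    (∀ x : ℝ, |gOsc x| ≤ 0.0000016) := by
  refine ⟨summable_fTerm, summable_expTerm_neg, summable_one_sub_expTerm, ⟨10, 0, fun k _ x => ?_⟩,
    exists_gOsc_ne, gOsc_periodic, ⟨?_, integral_gOsc⟩, abs_gOsc_le⟩
  · have hk : gOsc (x + k) = gOsc x := by simpa using gOsc_periodic.nat_mul k x
    have h := abs_fSum_sub_le (x + k)
    rwa [hk, neg_add'] at h
  · refine ContinuousOn.intervalIntegrable ?_
    rw [uIcc_of_le zero_le_one]
    exact continuousOn_gOsc
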